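/- Let $r>0$ and $\sigma>0$, put $\mu:=r-\frac{\sigma^2}{2}$, and let $X$ be the logarithmic price process of the one-dimensional Black--Scholes model with volatility $\sigma$ and discount rate $r$: for each $x\in\mathbb{R}$, under the risk-neutral measure $\mathbb{P}^x$ (with expectation $\mathbb{E}^x$) one has $X_0=x$ and $X_t=X_0+\sigma B_t+\mu t$ for all $t\ge 0$, where $B$ is a standard Brownian motion. Let $\gamma\in\mathbb{R}$ and let $G=(-\infty,\gamma]$ or $G=(-\infty,\gamma)$. For $h>0$ let $\tau_G^{h}:=\min\{t\in\{h,2h,3h,\dots\} : X_t\in G\}$ (with $\min\emptyset=+\infty$ and $e^{-r\cdot\infty}=0$), and for $s>0$ define the continuity correction at $\gamma$ by $$\rho(s)(\gamma):=\lim_{t\downarrow 0}\mathbb{E}^\gamma\left[e^{-r\tau_G^{t}}-e^{-r\tau_G^{s}}\right].$$ Then this limit exists for every $s>0$, and the following hold. 1. If $\mu\ge 0$, there exist constants $c_0,C_0>0$ such that for all sufficiently small $s>0$, $$c_0\,s^{\frac12}\le\rho(s)(\gamma)\le C_0\,s^{\frac1{2\sqrt2}}.$$ 2. If $\mu\le 0$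 and $r>\frac{\mu^2}{2\sigma^2}$, there exist constants $c_1,C_1>0$ such that for all sufficiently small $s>0$, $$c_1\,s^{\frac1{\sqrt2}}\le\rho(s)(\gamma)\le C_1\,s^{\frac12}.$$ 3. Hence, in either case, the dependence of the continuity correction on the mesh size is not polynomial: there is no real polynomial $p$ with $\rho(s)(\gamma)=p(s)+O(s)$ as $s\downarrow 0$; in particular $\rho(\cdot)(\gamma)$ does not agree with a polynomial for all sufficiently small $s>0$. -/

import Mathlib

open Set Filter Topology MeasureTheory ProbabilityTheory
open scoped NNReal ENNReal

noncomputable section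

namespace BermudanOption

/-- The log-price process `X` of the one-dimensional Black–Scholes model with volatility `σ` and
discount rate `r`, together with its family `P` of risk-neutral measures, indexed by the log
start-price `x`: under each `P x`, the process `B` is a standard Brownian motion, `X` starts at `x`,
and `X t = X 0 + σ * B t + (r - σ ^ 2 / 2) * t` for all times `t`. -/
structure IsBlackScholesLogPrice {Ω : Type*} [MeasurableSpace Ω] (r σ : ℝ)
    (B X : ℝ≥0 → Ω → ℝ) (P : ℝ → Measure Ω) : Prop where
  brownian : ∀ x, IsBrownianReal B (P x)
  start : ∀ x, ∀ᵐ ω ∂(P x), X 0 ω = x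
  path : ∀ x, ∀ᵐ ω ∂(P x), ∀ t : ℝ≥0, X t ω = X 0 ω + σ * B t ω + (r - σ ^ 2 / 2) * (t : ℝ)

/-- The set `h ℕ = {h, 2 h, 3 h, …}` of positive exercise times of mesh size `h`
(zero is not included). -/
def mesh (h : ℝ) : Set ℝ≥0 := {t | ∃ n : ℕ, 1 ≤ n ∧ (t : ℝ) = n * h}

/-- The entry time `min {t ∈ I : X t ∈ G}` of `X` into `G` along the set of times `I`. It is `∞`
if `X` is never in `G` at a time of `I`; for a mesh `I` of positive size the infimum is attained. -/
def entryTime {Ω : Type*} (X : ℝ≥0 → Ω → ℝ) (G : Set ℝ) (I : Set ℝ≥0) (ω : Ω) : ℝ≥0∞ :=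
  ⨅ t ∈ {t ∈ I | X t ω ∈ G}, (t : ℝ≥0∞)

/-- The discount factor `exp (- r τ)`, equal to `0` for `τ = ∞`. -/
def discount (r : ℝ) (τ : ℝ≥0∞) : ℝ := if τ = ∞ then 0 else Real.exp (-r * τ.toReal)

/-- `E [exp (-r τ_G^{t ℕ}) - exp (-r τ_G^{s ℕ})]`, the expectation being taken under `Q`. -/
def discountGap {Ω : Type*} [MeasurableSpace Ω] (r : ℝ) (X : ℝ≥0 → Ω → ℝ) (Q : Measure Ω)
    (G : Set ℝ) (s t : ℝ) : ℝ :=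
  ∫ ω, (discount r (entryTime X G (mesh t) ω) - discount r (entryTime X G (mesh s) ω)) ∂Q

/-- The continuity correction `ρ(s)(x) = lim_{t ↓ 0} E^x [exp (-r τ_G^{t ℕ}) - exp (-r τ_G^{s ℕ})]`
(meaningful whenever this limit exists). -/
def rho {Ω : Type*} [MeasurableSpace Ω] (r : ℝ) (X : ℝ≥0 → Ω → ℝ) (P : ℝ → Measure Ω)
    (G : Set ℝ) (s x : ℝ) : ℝ :=
  limUnder (𝓝[>] (0 : ℝ)) (fun t => discountGap r X (P x) G s t)

end BermudanOption

end

/-!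
The continuity correction at the boundary point is of exact order `√s`, whatever the sign of the
drift; since `1 / (2 √2) ≤ 1 / 2 ≤ 1 / √2`, the stated bounds follow, and a function of exact order
`√s` cannot be a polynomial up to `O(s)`.

On the mesh of size `s`, the log-price started at `γ` is `γ` plus a random walk with independent
Gaussian steps, and with `z = exp (-r s)` the expected discount factor is `E [z ^ τ]` for the first
positive time `τ` at which the walk leaves a half line `D`, which is `(0, ∞)` or `[0, ∞)`. Let
`u(s) = 1 - E [z ^ τ]` (`escape`). The discount gap of the meshes `s` and `t` is `u(s) - u(t)`
(`IsBlackScholesLogPrice.discountGap_eq`), so once `u(t) → 0` the limit exists and equals `u(s)`.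

*Lower bound* (`exists_mul_sqrt_le_escape`). For small `κ > 0` the process `z ^ n exp (-κ S n)` is a
supermartingale that is at least `z ^ n` outside `D`. Stopping it gives
`u(s) ≥ E [1 - exp (-κ S 1); S 1 ∈ D]` (`setIntegral_le_escape`), which is of order `√s` because
`S 1` exceeds `σ √s` with probability bounded below.

*Upper bound* (`exists_escape_bounds`). For fixed `n` and varying `k ≤ n`, the events that the walk
is outside `D` when looking from time `k` back to earlier times and inside `D` when looking from `k`
ahead are disjoint. By reversal and independence of the steps, their probabilities are products of
survival probabilities in `Dᶜ` and in `D`, and summing over `n` gives `u' u ≤ 1 - z ≤ r s`, where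
`u'` belongs to `Dᶜ` (`escape_mul_escape_compl_le`). By reflection `u'` belongs to a walk with the
opposite drift, to which the lower bound applies, so `u ≤ C √s`.
-/

namespace BermudanOption

/-! ### Survival probabilities of random walks -/

/-- The law of a sequence of independent steps with common law `ν`. -/
noncomputable abbrev stepLaw (ν : Measure ℝ) : Measure (ℕ → ℝ) := Measure.infinitePi fun _ => ν

/-- The step sequences whose walk, started at `0`, is in `D` at each of the times `1, …, n`
(the starting point itself is not constrained). -/
def survivalSet (D : Set ℝ) (n : ℕ) : Set (ℕ → ℝ) :=
  {x | ∀ j, 1 ≤ j → j ≤ n → ∑ i ∈ Finset.range j, x i ∈ D}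

/-- The probability that a walk with independent steps of law `ν` stays in `D` at the times
`1, …, n`. -/
noncomputable def survival (ν : Measure ℝ) (D : Set ℝ) (n : ℕ) : ℝ :=
  (stepLaw ν).real (survivalSet D n)

/-- For `τ` the first positive time at which the walk is outside `D`, this is `1 - E [z ^ τ]`,
written as `(1 - z) ∑ z ^ n P (n < τ)`. -/
noncomputable def escape (ν : Measure ℝ) (D : Set ℝ) (z : ℝ) : ℝ :=
  (1 - z) * ∑' n, z ^ n * survival ν D n

lemma measurableSet_survivalSet {D : Set ℝ} (hD : MeasurableSet D) (n : ℕ) :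
    MeasurableSet (survivalSet D n) := by
  simp only [survivalSet, ofPred_forall]
  refine .iInter fun j => .iInter fun _ => .iInter fun _ => ?_
  exact (by fun_prop : Measurable fun x : ℕ → ℝ => ∑ i ∈ Finset.range j, x i) hD

lemma survivalSet_antitone (D : Set ℝ) : Antitone (survivalSet D) :=
  fun _ _ h _ hx j h1 h2 => hx j h1 (h2.trans h)

@[simp] lemma survivalSet_zero (D : Set ℝ) : survivalSet D 0 = univ := by
  ext x
  simp only [survivalSet, mem_ofPred_eq, mem_univ, iff_true]
  intro j h1 h2
  omega

/-- Survival up to time `n` only involves the first `n` steps. -/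
lemma mem_survivalSet_congr {D : Set ℝ} {n : ℕ} {x y : ℕ → ℝ} (h : ∀ i < n, x i = y i) :
    x ∈ survivalSet D n ↔ y ∈ survivalSet D n := by
  have key : ∀ j ≤ n, ∑ i ∈ Finset.range j, x i = ∑ i ∈ Finset.range j, y i := fun j hj =>
    Finset.sum_congr rfl fun i hi => h i ((Finset.mem_range.1 hi).trans_le hj)
  constructor
  · intro hx j h1 h2
    rw [← key j h2]
    exact hx j h1 h2
  · intro hx j h1 h2
    rw [key j h2]
    exact hx j h1 h2

section Walk

variable {ν : Measure ℝ} {C D : Set ℝ}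

lemma survival_nonneg (n : ℕ) : 0 ≤ survival ν D n := measureReal_nonneg

lemma escape_nonneg {z : ℝ} (h0 : 0 ≤ z) (h1 : z < 1) : 0 ≤ escape ν D z :=
  mul_nonneg (by linarith) (tsum_nonneg fun n => mul_nonneg (pow_nonneg h0 n) (survival_nonneg n))

/-- Survival probabilities may be computed from any sequence of independent steps of law `ν`. -/
lemma survival_eq_of_iIndepFun {Ω : Type*} {mΩ : MeasurableSpace Ω} {Q : Measure Ω}
    {ξ : ℕ → Ω → ℝ} (hξ : iIndepFun ξ Q) (hlaw : ∀ i, HasLaw (ξ i) ν Q)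
    (hD : MeasurableSet D) (n : ℕ) :
    Q.real {ω | (fun i => ξ i ω) ∈ survivalSet D n} = survival ν D n :=
  (hξ.hasLaw_infinitePi hlaw (aemeasurable_pi_iff.2 fun i => (hlaw i).aemeasurable)).measureReal_eq
    (p := fun x => x ∈ survivalSet D n) (measurableSet_survivalSet hD n)

variable [IsProbabilityMeasure ν]

lemma survival_le_one (n : ℕ) : survival ν D n ≤ 1 := measureReal_le_one

lemma survival_zero : survival ν D 0 = 1 := by simp [survival]

lemma survival_one (hD : MeasurableSet D) : survival ν D 1 = ν.real D := by
  have h := measurePreserving_eval_infinitePi (fun _ : ℕ => ν) 0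
  have h2 : survivalSet D 1 = Function.eval 0 ⁻¹' D := by
    ext x
    simp only [survivalSet, mem_ofPred_eq, mem_preimage, Function.eval]
    constructor
    · intro h
      simpa using h 1 le_rfl le_rfl
    · intro h j h1 h2
      obtain rfl : j = 1 := by omega
      simpa using h
  rw [survival, h2, measureReal_def, h.measure_preimage hD.nullMeasurableSet, measureReal_def]

lemma summable_survival {z : ℝ} (h0 : 0 ≤ z) (h1 : z < 1) :
    Summable fun n => z ^ n * survival ν D n :=
  (summable_geometric_of_lt_one h0 h1).of_nonneg_of_le
    (fun n => mul_nonneg (pow_nonneg h0 n) (survival_nonneg n))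
    (fun n => mul_le_of_le_one_right (pow_nonneg h0 n) (survival_le_one n))

lemma iIndepFun_coord : iIndepFun (fun (i : ℕ) (x : ℕ → ℝ) => x i) (stepLaw ν) :=
  iIndepFun_infinitePi (X := fun _ => id) fun _ => measurable_id

lemma hasLaw_coord (i : ℕ) : HasLaw (fun x : ℕ → ℝ => x i) ν (stepLaw ν) :=
  (measurePreserving_eval_infinitePi (fun _ : ℕ => ν) i).hasLaw

/-- The law of the step sequence is invariant under injective reindexing. -/
lemma measurePreserving_reindex {e : ℕ → ℕ} (he : Function.Injective e) :
    MeasurePreserving (fun x : ℕ → ℝ => fun i => x (e i)) (stepLaw ν) (stepLaw ν) :=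
  ((iIndepFun_coord.precomp he).hasLaw_infinitePi (fun i => hasLaw_coord (e i))
    (by fun_prop : Measurable fun (x : ℕ → ℝ) i => x (e i)).aemeasurable).measurePreserving
      (by fun_prop)

/-- The first `k` steps and the steps after time `k` are independent. -/
lemma indepFun_truncate_shift (k : ℕ) :
    IndepFun (fun (x : ℕ → ℝ) i => if i < k then x i else 0)
      (fun (x : ℕ → ℝ) i => x (k + i)) (stepLaw ν) := by
  have hind := indep_iSup_of_disjoint (m := fun i : ℕ => MeasurableSpace.comap
    (fun x : ℕ → ℝ => x i) inferInstance) (μ := stepLaw ν)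
    (fun i => (measurable_pi_apply i).comap_le) iIndepFun_coord.iIndep
    (S := Iio k) (T := Ici k) (by
      rw [Set.disjoint_left]
      intro a ha hb
      exact absurd (mem_Iio.1 ha) (not_lt.2 hb))
  have hle : ∀ (S : Set ℕ), ∀ i ∈ S, Measurable[⨆ i ∈ S, MeasurableSpace.comap
      (fun x : ℕ → ℝ => x i) inferInstance] (fun x : ℕ → ℝ => x i) := by
    intro S i hi
    rw [measurable_iff_comap_le]
    exact le_iSup₂ (f := fun (i : ℕ) (_ : i ∈ S) => MeasurableSpace.comap
      (fun x : ℕ → ℝ => x i) inferInstance) i hi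
  rw [IndepFun_iff_Indep]
  refine indep_of_indep_of_le_left (indep_of_indep_of_le_right hind ?_) ?_
  · refine Measurable.comap_le ?_
    refine @measurable_pi_lambda _ _ _ (_) _ _ fun i => ?_
    exact hle _ _ (by simp)
  · refine Measurable.comap_le ?_
    refine @measurable_pi_lambda _ _ _ (_) _ _ fun i => ?_
    by_cases hi : i < k
    · simp only [hi, if_true]
      exact hle _ _ hi
    · simp only [hi, if_false]
      exact @measurable_const _ _ _ (_) _

/-- Reflecting the walk at the origin reflects the set in which it has to stay. -/
lemma survival_map_neg (hD : MeasurableSet D) (n : ℕ) :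
    survival (ν.map fun y => -y) (Neg.neg ⁻¹' D) n = survival ν D n := by
  have : IsProbabilityMeasure (ν.map fun y => -y) :=
    Measure.isProbabilityMeasure_map measurable_neg.aemeasurable
  rw [← survival_eq_of_iIndepFun (Q := stepLaw ν) (ξ := fun i x => -x i)
    (iIndepFun_infinitePi (X := fun _ y => -y) fun _ => measurable_neg)
    (fun i => (HasLaw.mk measurable_neg.aemeasurable rfl).fun_comp (hasLaw_coord i))
    (measurable_neg hD) n, survival]
  congr 1
  ext x
  simp [survivalSet]

lemma escape_map_neg (hD : MeasurableSet D) (z : ℝ) :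
    escape (ν.map fun y => -y) (Neg.neg ⁻¹' D) z = escape ν D z := by
  simp only [escape, survival_map_neg hD]

/-! ### Splitting a walk at its extremum -/

/-- The steps for which, seen from time `k`, the walk was outside `C` before and is in `C`
afterwards, up to time `n`. For `C = (0, ∞)` this says that `k` is the last time up to `n` at which
the walk attains its minimum. -/
def splitSet (C : Set ℝ) (k n : ℕ) : Set (ℕ → ℝ) :=
  {x | (∀ j < k, ∑ i ∈ Finset.Ico j k, x i ∉ C) ∧
    ∀ j, k < j → j ≤ n → ∑ i ∈ Finset.Ico k j, x i ∈ C}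

lemma splitSet_eq (C : Set ℝ) (k m : ℕ) : splitSet C k (k + m) =
    ((fun (x : ℕ → ℝ) i => if i < k then x i else 0) ⁻¹'
      ((fun (x : ℕ → ℝ) i => x (if i < k then k - 1 - i else i)) ⁻¹' survivalSet Cᶜ k)) ∩
    ((fun (x : ℕ → ℝ) i => x (k + i)) ⁻¹' survivalSet C m) := by
  ext x
  have h1 : ∀ j ≤ k, ∑ i ∈ Finset.range j, (fun i => if i < k then x i else 0)
      (if i < k then k - 1 - i else i) = ∑ i ∈ Finset.Ico (k - j) k, x i := by
    intro j hj
    rw [← Finset.sum_range_reflect, Finset.sum_Ico_eq_sum_range, Nat.sub_sub_self hj]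
    refine Finset.sum_congr rfl fun i hi => ?_
    have hi := Finset.mem_range.1 hi
    beta_reduce
    rw [if_pos (by omega : j - 1 - i < k), if_pos (by omega)]
    congr 1
    omega
  have h2 : ∀ j, ∑ i ∈ Finset.range j, x (k + i) = ∑ i ∈ Finset.Ico k (k + j), x i := by
    intro j
    rw [Finset.sum_Ico_eq_sum_range, Nat.add_sub_cancel_left]
  constructor
  · rintro ⟨ha, hb⟩
    refine ⟨fun j hj1 hj2 => ?_, fun j hj1 hj2 => ?_⟩
    · rw [h1 j hj2]
      exact ha _ (by omega)
    · rw [h2]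
      exact hb _ (by omega) (by omega)
  · rintro ⟨ha, hb⟩
    refine ⟨fun j hj => ?_, fun j hj1 hj2 => ?_⟩
    · have := ha (k - j) (by omega) (by omega)
      rw [h1 _ (by omega), Nat.sub_sub_self hj.le] at this
      exact this
    · have := hb (j - k) (by omega) (by omega)
      rw [h2, Nat.add_sub_cancel' hj1.le] at this
      exact this

/-- Reversing the order of the first `k` steps turns the past of time `k` into a survival event. -/
lemma measure_splitSet (hC : MeasurableSet C) (k m : ℕ) :
    (stepLaw ν).real (splitSet C k (k + m)) = survival ν Cᶜ k * survival ν C m := by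
  have hrev : Function.Injective fun i => if i < k then k - 1 - i else i := by
    intro i j hij
    simp only at hij
    split_ifs at hij <;> omega
  have hm : Measurable fun (x : ℕ → ℝ) i => x (if i < k then k - 1 - i else i) := by fun_prop
  have hA := hm (measurableSet_survivalSet hC.compl k)
  have hB := measurableSet_survivalSet hC m
  rw [splitSet_eq, measureReal_def,
    (indepFun_truncate_shift k).measure_inter_preimage_eq_mul _ _ hA hB, ENNReal.toReal_mul,
    (measurePreserving_reindex (ν := ν) (add_right_injective k)).measure_preimage
      hB.nullMeasurableSet]
  congr 2
  rw [← (measurePreserving_reindex (ν := ν) hrev).measure_preimage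
    (measurableSet_survivalSet hC.compl k).nullMeasurableSet]
  congr 1
  ext x
  refine mem_survivalSet_congr fun i hi => ?_
  simp only [hi, if_true]
  rw [if_pos (by omega)]

lemma disjoint_splitSet {k l n : ℕ} (hkl : k < l) (hl : l ≤ n) :
    Disjoint (splitSet C k n) (splitSet C l n) := by
  rw [Set.disjoint_left]
  intro x hx hy
  exact hy.1 k hkl (hx.2 l hkl hl)

/-- The events that the walk splits at `k`, for `k ≤ n`, are disjoint. (For a half line they also
exhaust the space, but only this inequality is needed.) -/
lemma sum_survival_mul_le_one (hC : MeasurableSet C) (n : ℕ) :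
    ∑ p ∈ Finset.HasAntidiagonal.antidiagonal n, survival ν Cᶜ p.1 * survival ν C p.2 ≤ 1 := by
  have hms : ∀ k ∈ Finset.range (n + 1), MeasurableSet (splitSet C k n) := by
    intro k hk
    obtain ⟨m, rfl⟩ := Nat.exists_eq_add_of_le (Nat.lt_succ_iff.1 (Finset.mem_range.1 hk))
    rw [splitSet_eq]
    refine MeasurableSet.inter ?_ ?_
    · have h1 : Measurable fun (x : ℕ → ℝ) i => x (if i < k then k - 1 - i else i) := by fun_prop
      have h2 : Measurable fun (x : ℕ → ℝ) i => if i < k then x i else 0 := by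
        refine measurable_pi_lambda _ fun i => ?_
        split_ifs <;> fun_prop
      exact h2 (h1 (measurableSet_survivalSet hC.compl k))
    · exact (by fun_prop : Measurable fun (x : ℕ → ℝ) i => x (k + i))
        (measurableSet_survivalSet hC m)
  rw [Finset.Nat.sum_antidiagonal_eq_sum_range_succ_mk]
  calc ∑ k ∈ Finset.range (n + 1), survival ν Cᶜ k * survival ν C (n - k)
      = ∑ k ∈ Finset.range (n + 1), (stepLaw ν).real (splitSet C k n) := by
        refine Finset.sum_congr rfl fun k hk => ?_
        rw [← measure_splitSet hC,
          Nat.add_sub_cancel' (Nat.lt_succ_iff.1 (Finset.mem_range.1 hk))]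
    _ = (stepLaw ν).real (⋃ k ∈ Finset.range (n + 1), splitSet C k n) := by
        rw [measureReal_biUnion_finset _ hms]
        intro k hk l hl hkl
        simp only [Finset.coe_range, mem_Iio] at hk hl
        rcases hkl.lt_or_gt with h | h
        · exact disjoint_splitSet h (by omega)
        · exact (disjoint_splitSet h (by omega)).symm
    _ ≤ 1 := measureReal_le_one

/-- The inequality in the Wiener–Hopf factorization
`(1 - E [z ^ τ]) (1 - E [z ^ τ']) = 1 - z`, with `τ` and `τ'` the first times outside and
inside `C`. -/
lemma escape_mul_escape_compl_le (hC : MeasurableSet C) {z : ℝ} (h0 : 0 ≤ z) (h1 : z < 1) :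
    escape ν Cᶜ z * escape ν C z ≤ 1 - z := by
  have hz : 0 < 1 - z := by linarith
  have hs1 := summable_survival (ν := ν) (D := Cᶜ) h0 h1
  have hs2 := summable_survival (ν := ν) (D := C) h0 h1
  have hcauchy := tsum_mul_tsum_eq_tsum_sum_antidiagonal_of_summable_norm hs1.norm hs2.norm
  have hterm : ∀ n, ∑ p ∈ Finset.HasAntidiagonal.antidiagonal n,
      z ^ p.1 * survival ν Cᶜ p.1 * (z ^ p.2 * survival ν C p.2) ≤ z ^ n := by
    intro n
    have : ∑ p ∈ Finset.HasAntidiagonal.antidiagonal n,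
        z ^ p.1 * survival ν Cᶜ p.1 * (z ^ p.2 * survival ν C p.2) =
        z ^ n * ∑ p ∈ Finset.HasAntidiagonal.antidiagonal n, survival ν Cᶜ p.1 * survival ν C p.2 := by
      rw [Finset.mul_sum]
      refine Finset.sum_congr rfl fun p hp => ?_
      rw [← Finset.HasAntidiagonal.mem_antidiagonal.1 hp, pow_add]
      ring
    rw [this]
    exact mul_le_of_le_one_right (pow_nonneg h0 n) (sum_survival_mul_le_one hC n)
  have hle : (∑' n, z ^ n * survival ν Cᶜ n) * ∑' n, z ^ n * survival ν C n ≤ (1 - z)⁻¹ := by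
    rw [hcauchy, ← tsum_geometric_of_lt_one h0 h1]
    exact (summable_norm_sum_mul_antidiagonal_of_summable_norm hs1.norm hs2.norm).of_norm
      |>.tsum_le_tsum hterm (summable_geometric_of_lt_one h0 h1)
  calc escape ν Cᶜ z * escape ν C z
      = (1 - z) ^ 2 * ((∑' n, z ^ n * survival ν Cᶜ n) * ∑' n, z ^ n * survival ν C n) := by
        simp only [escape]
        ring
    _ ≤ (1 - z) ^ 2 * (1 - z)⁻¹ := by gcongr
    _ = 1 - z := by field_simp

/-! ### The exponential supermartingale -/

/-- The exponential `z ^ n * exp (-κ S n)` is a supermartingale which is at least `z ^ n` outside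
`D`. Stopping it at the exit from `D`, but not before time `1`, bounds `E [z ^ τ]` by
`P (S 1 ∉ D) + E [exp (-κ S 1); S 1 ∈ D]`. -/
lemma setIntegral_le_escape (hD : MeasurableSet D) {z κ : ℝ} (h0 : 0 ≤ z) (h1 : z < 1)
    (hint : Integrable (fun y => Real.exp (-κ * y)) ν)
    (hκ : z * ∫ y, Real.exp (-κ * y) ∂ν ≤ 1) (hexit : ∀ y ∉ D, κ * y ≤ 0) :
    ∫ y in D, (1 - Real.exp (-κ * y)) ∂ν ≤ escape ν D z := by
  classical
  -- `f n` is the exponential of the walk at time `n`, killed at the exit from `D`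
  set f : ℕ → (ℕ → ℝ) → ℝ := fun n => (survivalSet D n).indicator
    fun x => Real.exp (-κ * ∑ i ∈ Finset.range n, x i) with hf
  set g : ℕ → (ℕ → ℝ) → ℝ := fun n => (survivalSet D n).indicator
    fun x => Real.exp (-κ * ∑ i ∈ Finset.range (n + 1), x i) with hg
  have hmS := fun n => measurableSet_survivalSet hD n
  have hgf : ∀ n x, g n x = f n x * Real.exp (-κ * x n) := by
    intro n x
    simp only [hf, hg, Set.indicator_apply]
    split_ifs
    · rw [← Real.exp_add, Finset.sum_range_succ]
      ring_nf
    · simp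
  have hfm : ∀ n, Measurable (f n) := fun n =>
    Measurable.indicator (by fun_prop) (hmS n)
  have hindep : ∀ n, IndepFun (f n) (fun x => Real.exp (-κ * x n)) (stepLaw ν) := by
    intro n
    have h := (indepFun_truncate_shift (ν := ν) n).comp (φ := f n)
      (ψ := fun x => Real.exp (-κ * x 0)) (hfm n) (by fun_prop)
    convert! h using 1
    ext x
    have hmem := mem_survivalSet_congr (D := D) (n := n) (x := x)
      (y := fun i => if i < n then x i else 0) (fun i hi => by simp [hi])
    have hsum : ∑ i ∈ Finset.range n, (if i < n then x i else 0) = ∑ i ∈ Finset.range n, x i :=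
      Finset.sum_congr rfl fun i hi => if_pos (Finset.mem_range.1 hi)
    simp only [hf, Function.comp, Set.indicator_apply, hmem, hsum]
  have hexpint : ∀ n, Integrable (fun x : ℕ → ℝ => Real.exp (-κ * x n)) (stepLaw ν) := by
    intro n
    have := (hasLaw_coord (ν := ν) n)
    have h2 : Integrable (fun y => Real.exp (-κ * y)) ((stepLaw ν).map fun x => x n) := by
      rwa [this.map_eq]
    exact h2.comp_aemeasurable this.aemeasurable
  have hfint : ∀ n, Integrable (f n) (stepLaw ν) ∧ Integrable (g n) (stepLaw ν) := by
    intro n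
    induction n with
    | zero =>
      have h : Integrable (f 0) (stepLaw ν) := by
        simp only [hf, survivalSet_zero, indicator_univ, Finset.range_zero, Finset.sum_empty,
          mul_zero, Real.exp_zero]
        exact integrable_const _
      refine ⟨h, ?_⟩
      rw [funext (hgf 0)]
      exact (hindep 0).integrable_mul h (hexpint 0)
    | succ n ih =>
      have h : Integrable (f (n + 1)) (stepLaw ν) := by
        have : f (n + 1) = (survivalSet D (n + 1)).indicator (g n) := by
          ext x
          simp only [hf, hg, Set.indicator_apply]
          split_ifs with ha hb
          · rfl
          · exact absurd (survivalSet_antitone D (Nat.le_succ n) ha) hb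
          · rfl
        rw [this]
        exact ih.2.indicator (hmS _)
      refine ⟨h, ?_⟩
      rw [funext (hgf (n + 1))]
      exact (hindep _).integrable_mul h (hexpint _)
  set m : ℕ → ℝ := fun n => z ^ n * ∫ x, f n x ∂(stepLaw ν) with hm
  have hfpos : ∀ n x, 0 ≤ f n x := fun n x => indicator_nonneg (fun _ _ => (Real.exp_pos _).le) x
  have hm0 : ∀ n, 0 ≤ m n := fun n =>
    mul_nonneg (pow_nonneg h0 n) (integral_nonneg (hfpos n))
  have hstep : ∀ n, m (n + 1) + z ^ (n + 1) * (survival ν D n - survival ν D (n + 1)) ≤ m n := by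
    intro n
    have hg_int : ∫ x, g n x ∂(stepLaw ν) =
        (∫ x, f n x ∂(stepLaw ν)) * ∫ y, Real.exp (-κ * y) ∂ν := by
      simp_rw [hgf]
      rw [(hindep n).integral_fun_mul_eq_mul_integral (hfm n).aestronglyMeasurable
        (hexpint n).aestronglyMeasurable]
      congr 1
      exact (hasLaw_coord (ν := ν) n).integral_comp
        (f := fun y => Real.exp (-κ * y)) (by fun_prop)
    -- paths leaving `D` at time `n + 1` contribute at least `1` each, the others `f (n + 1)`
    have hg_low : (∫ x, f (n + 1) x ∂(stepLaw ν)) + (survival ν D n - survival ν D (n + 1)) ≤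
        ∫ x, g n x ∂(stepLaw ν) := by
      have hdiff : survival ν D n - survival ν D (n + 1) =
          ∫ x, (survivalSet D n \ survivalSet D (n + 1)).indicator (fun _ => (1 : ℝ)) x ∂(stepLaw ν) := by
        change _ = ∫ x, (survivalSet D n \ survivalSet D (n + 1)).indicator (1 : (ℕ → ℝ) → ℝ) x
          ∂(stepLaw ν)
        rw [integral_indicator_one ((hmS _).diff (hmS _)),
          measureReal_sdiff (survivalSet_antitone D (Nat.le_succ n)) (hmS _)]
        rfl
      rw [hdiff, ← integral_add (hfint _).1
        ((integrable_const (1 : ℝ)).indicator ((hmS _).diff (hmS _)))]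
      refine integral_mono ((hfint _).1.add
        ((integrable_const (1 : ℝ)).indicator ((hmS _).diff (hmS _)))) (hfint n).2 fun x => ?_
      by_cases ha : x ∈ survivalSet D (n + 1)
      · have hb := survivalSet_antitone D (Nat.le_succ n) ha
        simp [hf, hg, ha, hb]
      · by_cases hb : x ∈ survivalSet D n
        · have hout : ∑ i ∈ Finset.range (n + 1), x i ∉ D := by
            intro hin
            refine ha fun j hj1 hj2 => ?_
            rcases Nat.lt_or_ge n j with h | h
            · obtain rfl : j = n + 1 := by omega
              exact hin
            · exact hb j hj1 h
          have := hexit _ hout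
          simp only [hf, hg, ha, hb, indicator_of_notMem, not_false_eq_true, indicator_of_mem,
            Set.mem_sdiff, and_self, zero_add]
          rw [Real.one_le_exp_iff]
          linarith
        · simp [hf, hg, ha, hb]
    have hz : z ^ (n + 1) * ∫ x, g n x ∂(stepLaw ν) ≤ m n := by
      rw [hg_int]
      calc z ^ (n + 1) * ((∫ x, f n x ∂(stepLaw ν)) * ∫ y, Real.exp (-κ * y) ∂ν)
          = m n * (z * ∫ y, Real.exp (-κ * y) ∂ν) := by
            simp only [hm]
            ring
        _ ≤ m n := mul_le_of_le_one_right (hm0 n) hκ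
    have := mul_le_mul_of_nonneg_left hg_low (pow_nonneg h0 (n + 1))
    simp only [hm] at hz ⊢
    linarith
  have hm1 : m 1 = z * ∫ y in D, Real.exp (-κ * y) ∂ν := by
    simp only [hm, pow_one]
    congr 1
    rw [← integral_indicator hD, ← (hasLaw_coord (ν := ν) 0).integral_comp
      (f := D.indicator fun y => Real.exp (-κ * y))
      (Measurable.indicator (by fun_prop) hD).aestronglyMeasurable]
    refine integral_congr_ae (ae_of_all _ fun x => ?_)
    have : x ∈ survivalSet D 1 ↔ x 0 ∈ D := by
      constructor
      · intro h
        simpa using h 1 le_rfl le_rfl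
      · intro h j h1 h2
        obtain rfl : j = 1 := by omega
        simpa using h
    simp [hf, Set.indicator_apply, this]
  have hpartial : ∀ N, (1 - z) + z * survival ν D 1 - m 1 ≤
      (1 - z) * ∑ n ∈ Finset.range (N + 1), z ^ n * survival ν D n +
        z ^ (N + 1) * survival ν D (N + 1) - m (N + 1) := by
    intro N
    induction N with
    | zero => simp [survival_zero]
    | succ N ih =>
      rw [Finset.sum_range_succ]
      have := hstep (N + 1)
      have e : z ^ (N + 1 + 1) = z * z ^ (N + 1) := by ring
      rw [e] at this ⊢
      linarith
  have hlim : Tendsto (fun N => (1 - z) * ∑ n ∈ Finset.range (N + 1), z ^ n * survival ν D n +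
      z ^ (N + 1)) atTop (𝓝 (escape ν D z + 0)) := by
    refine Tendsto.add ?_ ?_
    · exact ((summable_survival h0 h1).hasSum.tendsto_sum_nat.comp
        (tendsto_add_atTop_nat 1)).const_mul _
    · exact (tendsto_pow_atTop_nhds_zero_of_lt_one h0 h1).comp (tendsto_add_atTop_nat 1)
  rw [add_zero] at hlim
  have hfin : (1 - z) + z * survival ν D 1 - m 1 ≤ escape ν D z := by
    refine ge_of_tendsto' hlim fun N => (hpartial N).trans ?_
    have h2 := mul_le_of_le_one_right (pow_nonneg h0 (N + 1)) (survival_le_one (ν := ν) (D := D)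
      (N + 1))
    linarith [hm0 (N + 1)]
  refine le_trans ?_ hfin
  rw [integral_sub (integrable_const _).integrableOn hint.integrableOn, hm1, survival_one hD]
  simp only [integral_const, measureReal_restrict_apply_univ, smul_eq_mul, mul_one]
  have hI : 0 ≤ ∫ y in D, Real.exp (-κ * y) ∂ν := integral_nonneg fun y => (Real.exp_pos _).le
  have hD1 : ν.real D ≤ 1 := measureReal_le_one
  nlinarith

end Walk

/-! ### Gaussian walks with small steps -/

/-- The law of the increment of a Brownian motion with drift `m` and volatility `σ` over a time
step of length `s`. -/
noncomputable abbrev incrementLaw (m σ s : ℝ) : Measure ℝ :=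
  gaussianReal (m * s) (σ ^ 2 * s).toNNReal

lemma incrementLaw_eq_map {m σ s : ℝ} (hs : 0 ≤ s) :
    incrementLaw m σ s =
      ((gaussianReal 0 1).map (fun y => σ * √s * y)).map (fun y => y + m * s) := by
  have hv : (σ ^ 2 * s).toNNReal = NNReal.mk ((σ * √s) ^ 2) (sq_nonneg _) := by
    ext
    rw [Real.coe_toNNReal _ (by positivity)]
    simp [mul_pow, Real.sq_sqrt hs]
  rw [gaussianReal_map_const_mul, gaussianReal_map_add_const, mul_zero, zero_add, mul_one,
    incrementLaw, hv]

lemma half_le_one_sub_exp_neg {x : ℝ} (h0 : 0 ≤ x) (h1 : x ≤ 1) :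
    x / 2 ≤ 1 - Real.exp (-x) := by
  have h2 : Real.exp (-x) ≤ (1 + x)⁻¹ := by
    rw [Real.exp_neg]
    gcongr
    linarith [Real.add_one_le_exp x]
  have h3 : 1 - (1 + x)⁻¹ = x / (1 + x) := by
    field_simp
    ring
  have h4 : x / 2 ≤ x / (1 + x) := by
    gcongr
    linarith
  linarith

lemma gaussianReal_Ici_pos : 0 < (gaussianReal 0 1).real (Ici 2) := by
  rw [measureReal_def, ENNReal.toReal_pos_iff]
  refine ⟨?_, measure_lt_top _ _⟩
  refine pos_iff_ne_zero.2 fun h => ?_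
  have := gaussianReal_absolutelyContinuous' 0 (one_ne_zero : (1 : ℝ≥0) ≠ 0) h
  simp at this

lemma incrementLaw_Ici_ge {m σ s : ℝ} (hσ : 0 < σ) (hs : 0 < s) (h : |m| * √s ≤ σ) :
    (gaussianReal 0 1).real (Ici 2) ≤ (incrementLaw m σ s).real (Ici (σ * √s)) := by
  rw [incrementLaw_eq_map hs.le, Measure.map_map (by fun_prop) (by fun_prop),
    map_measureReal_apply (by fun_prop) measurableSet_Ici]
  refine measureReal_mono fun y hy => ?_
  have hs' : 0 < √s := Real.sqrt_pos.2 hs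
  have hy : 2 ≤ y := hy
  have h1 : √s * √s = s := Real.mul_self_sqrt hs.le
  have h2 : -(σ * √s) ≤ m * s := by
    have := neg_abs_le m
    have h3 : |m| * s ≤ σ * √s := by
      calc |m| * s = |m| * √s * √s := by rw [mul_assoc, h1]
        _ ≤ σ * √s := by gcongr
    nlinarith
  have h4 : σ * √s * 2 ≤ σ * √s * y := by gcongr
  simp only [mem_preimage, Function.comp, mem_Ici]
  linarith

lemma tendsto_const_mul_sqrt (a : ℝ) : Tendsto (fun s => a * √s) (𝓝[>] 0) (𝓝 0) := by
  have : Continuous fun s => a * √s := by fun_prop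
  have h := this.tendsto 0
  simp only [Real.sqrt_zero, mul_zero] at h
  exact h.mono_left nhdsWithin_le_nhds

/-- With probability bounded below the first step is at least `σ √s`; from there the walk has a
chance of order `√s` not to leave the half line before an independent exponential time of
rate `r`. This holds for every drift. -/
lemma exists_mul_sqrt_le_escape {r σ : ℝ} (hr : 0 < r) (hσ : 0 < σ) (m : ℝ) :
    ∃ c : ℝ, 0 < c ∧ ∀ᶠ s : ℝ in 𝓝[>] 0, ∀ D : Set ℝ, MeasurableSet D → Ioi 0 ⊆ D → D ⊆ Ici 0 →
      c * √s ≤ escape (incrementLaw m σ s) D (Real.exp (-r * s)) := by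
  set κ : ℝ := r / (σ ^ 2 / 2 + |m| + r) with hκ
  have hden : 0 < σ ^ 2 / 2 + |m| + r := by positivity
  have hκ0 : 0 < κ := by positivity
  have hκ1 : κ ≤ 1 := by
    rw [hκ, div_le_one hden]
    have : 0 ≤ σ ^ 2 / 2 + |m| := by positivity
    linarith
  -- the choice of `κ` makes the discounted exponential of the walk a supermartingale
  have hκr : -κ * m + σ ^ 2 * κ ^ 2 / 2 ≤ r := by
    have h1 : κ * (σ ^ 2 / 2 + |m| + r) = r := by
      rw [hκ]
      field_simp
    have h2 : -κ * m ≤ κ * |m| := by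
      have := neg_le_abs m
      nlinarith
    have h3 : σ ^ 2 * κ ^ 2 / 2 ≤ κ * (σ ^ 2 / 2) := by
      have : κ ^ 2 ≤ κ := by nlinarith
      have := mul_le_mul_of_nonneg_left this (sq_nonneg σ)
      linarith
    have : 0 < κ * r := by positivity
    linarith
  refine ⟨(gaussianReal 0 1).real (Ici 2) * (κ * σ / 2),
    mul_pos gaussianReal_Ici_pos (by positivity), ?_⟩
  filter_upwards [self_mem_nhdsWithin,
    (tendsto_const_mul_sqrt |m|).eventually (eventually_le_nhds hσ),
    (tendsto_const_mul_sqrt (κ * σ)).eventually (eventually_le_nhds one_pos)]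
    with s hs hs1 hs2 D hD hD1 hD2
  have hs : 0 < s := hs
  have hs' : 0 < √s := Real.sqrt_pos.2 hs
  have hint := integrable_exp_mul_gaussianReal (μ := m * s) (v := (σ ^ 2 * s).toNNReal) (-κ)
  have hmgf : ∫ y, Real.exp (-κ * y) ∂(incrementLaw m σ s) =
      Real.exp (m * s * -κ + σ ^ 2 * s * (-κ) ^ 2 / 2) := by
    have := congrFun (mgf_fun_id_gaussianReal (μ := m * s) (v := (σ ^ 2 * s).toNNReal)) (-κ)
    rw [Real.coe_toNNReal _ (by positivity)] at this
    exact this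
  refine le_trans ?_ (setIntegral_le_escape (κ := κ) hD (Real.exp_pos _).le ?_ hint ?_ ?_)
  · have hIci : Ici (σ * √s) ⊆ D := fun y hy =>
      hD1 (lt_of_lt_of_le (by positivity : 0 < σ * √s) hy)
    have hI : IntegrableOn (fun y => 1 - Real.exp (-κ * y)) D (incrementLaw m σ s) :=
      ((integrable_const _).sub hint).integrableOn
    calc (gaussianReal 0 1).real (Ici 2) * (κ * σ / 2) * √s
        = (gaussianReal 0 1).real (Ici 2) * (κ * (σ * √s) / 2) := by ring
      _ ≤ (incrementLaw m σ s).real (Ici (σ * √s)) * (1 - Real.exp (-(κ * (σ * √s)))) := by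
          refine mul_le_mul (incrementLaw_Ici_ge hσ hs hs1)
            (half_le_one_sub_exp_neg (by positivity) (by linarith)) (by positivity)
            measureReal_nonneg
      _ = ∫ y in Ici (σ * √s), (1 - Real.exp (-(κ * (σ * √s)))) ∂(incrementLaw m σ s) := by
          rw [setIntegral_const, smul_eq_mul]
      _ ≤ ∫ y in Ici (σ * √s), (1 - Real.exp (-κ * y)) ∂(incrementLaw m σ s) := by
          refine setIntegral_mono_on (integrable_const _).integrableOn (hI.mono_set hIci)
            measurableSet_Ici fun y hy => ?_
          have hy : σ * √s ≤ y := hy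
          rw [neg_mul]
          gcongr
      _ ≤ ∫ y in D, (1 - Real.exp (-κ * y)) ∂(incrementLaw m σ s) := by
          refine setIntegral_mono_set hI ?_ (LE.le.eventuallyLE hIci)
          filter_upwards [ae_restrict_mem hD] with y hy
          have hy : 0 ≤ y := hD2 hy
          have : Real.exp (-κ * y) ≤ 1 := Real.exp_le_one_iff.2 (by nlinarith)
          simpa using this
  · rw [Real.exp_lt_one_iff]
    nlinarith
  · rw [hmgf, ← Real.exp_add, Real.exp_le_one_iff]
    nlinarith
  · intro y hy
    have : y ≤ 0 := not_lt.1 fun h => hy (hD1 h)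
    nlinarith

/-- Reflection and the Wiener–Hopf inequality turn the lower bound for the opposite drift into an
upper bound. -/
lemma exists_escape_bounds {r σ : ℝ} (hr : 0 < r) (hσ : 0 < σ) (m : ℝ) :
    ∃ c C : ℝ, 0 < c ∧ 0 < C ∧ ∀ᶠ s : ℝ in 𝓝[>] 0, ∀ D : Set ℝ, MeasurableSet D →
      Ioi 0 ⊆ D → D ⊆ Ici 0 →
      c * √s ≤ escape (incrementLaw m σ s) D (Real.exp (-r * s)) ∧
      escape (incrementLaw m σ s) D (Real.exp (-r * s)) ≤ C * √s := by
  obtain ⟨c, hc, h⟩ := exists_mul_sqrt_le_escape hr hσ m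
  obtain ⟨c', hc', h'⟩ := exists_mul_sqrt_le_escape hr hσ (-m)
  refine ⟨c, r / c', hc, by positivity, ?_⟩
  filter_upwards [h, h', self_mem_nhdsWithin] with s hs hs' hpos D hD hD1 hD2
  have hpos : 0 < s := hpos
  have hsq : 0 < √s := Real.sqrt_pos.2 hpos
  refine ⟨hs D hD hD1 hD2, ?_⟩
  have hz0 := (Real.exp_pos (-r * s)).le
  have hz1 : Real.exp (-r * s) < 1 := by
    rw [Real.exp_lt_one_iff]
    nlinarith
  have hlow : c' * √s ≤ escape (incrementLaw m σ s) Dᶜ (Real.exp (-r * s)) := by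
    have := hs' (Neg.neg ⁻¹' Dᶜ) (measurable_neg hD.compl)
      (fun y hy hn => by
        have h1 : 0 ≤ -y := hD2 hn
        have h2 : 0 < y := hy
        linarith)
      (fun y hy => not_lt.1 fun hn => hy (hD1 (by simpa using hn)))
    rwa [incrementLaw, neg_mul, ← gaussianReal_map_neg, escape_map_neg hD.compl] at this
  have hprod := escape_mul_escape_compl_le (ν := incrementLaw m σ s) hD hz0 hz1
  have hz : 1 - Real.exp (-r * s) ≤ r * s := by linarith [Real.add_one_le_exp (-r * s)]
  have hmul := mul_le_mul_of_nonneg_right hlow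
    (escape_nonneg (ν := incrementLaw m σ s) (D := D) hz0 hz1)
  have hfin : c' * √s * escape (incrementLaw m σ s) D (Real.exp (-r * s)) ≤ r * (√s * √s) := by
    rw [Real.mul_self_sqrt hpos.le]
    linarith
  rw [div_mul_eq_mul_div, le_div_iff₀ hc']
  refine le_of_mul_le_mul_right ?_ hsq
  linarith

/-! ### Entry times along a mesh -/

lemma mem_mesh_iff {H t : ℝ≥0} : t ∈ mesh (H : ℝ) ↔ ∃ n : ℕ, 1 ≤ n ∧ t = n * H := by
  simp only [mesh, mem_ofPred_eq, ← NNReal.coe_inj, NNReal.coe_mul, NNReal.coe_natCast]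

section Path

variable {Ω : Type*} {X : ℝ≥0 → Ω → ℝ} {G : Set ℝ} {H : ℝ≥0} {ω : Ω}

lemma entryTime_eq_top (h : ∀ n : ℕ, 1 ≤ n → X (n * H) ω ∉ G) :
    entryTime X G (mesh H) ω = ∞ := by
  simp only [entryTime, iInf_eq_top]
  rintro t ⟨ht, htG⟩
  obtain ⟨n, hn, rfl⟩ := mem_mesh_iff.1 ht
  exact absurd htG (h n hn)

lemma entryTime_eq {N : ℕ} (h1 : 1 ≤ N) (hN : X (N * H) ω ∈ G)
    (hmin : ∀ n : ℕ, 1 ≤ n → n < N → X (n * H) ω ∉ G) :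
    entryTime X G (mesh H) ω = ((N * H : ℝ≥0) : ℝ≥0∞) := by
  refine le_antisymm (iInf₂_le (N * H : ℝ≥0) ⟨mem_mesh_iff.2 ⟨N, h1, rfl⟩, hN⟩) ?_
  refine le_iInf₂ fun t ht => ?_
  obtain ⟨n, hn, rfl⟩ := mem_mesh_iff.1 ht.1
  have : N ≤ n := not_lt.1 fun hlt => hmin n hn hlt ht.2
  have h2 : (N : ℝ≥0) ≤ n := by exact_mod_cast this
  exact ENNReal.coe_le_coe.2 (by gcongr)

open Classical in
/-- Summation by parts: `1 - z ^ τ = (1 - z) ∑ z ^ n` over the `n < τ`, also for `τ = ∞`. -/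
lemma discount_entryTime {r : ℝ} (hr : 0 < r) (hH : 0 < H) :
    discount r (entryTime X G (mesh H) ω) = 1 - (1 - Real.exp (-r * H)) *
      ∑' n : ℕ, Real.exp (-r * H) ^ n *
        (if ∀ j : ℕ, 1 ≤ j → j ≤ n → X (j * H) ω ∉ G then 1 else 0) := by
  set z := Real.exp (-r * H) with hz
  have hz0 : 0 ≤ z := (Real.exp_pos _).le
  have hz1 : z < 1 := by
    rw [hz, Real.exp_lt_one_iff]
    have : 0 < (H : ℝ) := hH
    nlinarith
  by_cases hex : ∃ n : ℕ, 1 ≤ n ∧ X (n * H) ω ∈ G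
  · set N := Nat.find hex with hNdef
    obtain ⟨hN1, hN2⟩ : 1 ≤ N ∧ X (N * H) ω ∈ G := Nat.find_spec hex
    have hmin : ∀ n : ℕ, 1 ≤ n → n < N → X (n * H) ω ∉ G := fun n hn hlt hin =>
      Nat.find_min hex hlt ⟨hn, hin⟩
    have hiff : ∀ n, (∀ j : ℕ, 1 ≤ j → j ≤ n → X (j * H) ω ∉ G) ↔ n < N := by
      intro n
      constructor
      · intro h
        by_contra hle
        exact h N hN1 (not_lt.1 hle) hN2
      · intro h j hj1 hj2
        exact hmin j hj1 (by omega)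
    rw [entryTime_eq hN1 hN2 hmin, discount, if_neg ENNReal.coe_ne_top,
      tsum_eq_sum (s := Finset.range N)]
    · have : ∑ n ∈ Finset.range N, z ^ n *
          (if ∀ j : ℕ, 1 ≤ j → j ≤ n → X (j * H) ω ∉ G then (1 : ℝ) else 0) =
          ∑ n ∈ Finset.range N, z ^ n := by
        refine Finset.sum_congr rfl fun n hn => ?_
        rw [if_pos ((hiff n).2 (Finset.mem_range.1 hn)), mul_one]
      rw [this, mul_neg_geom_sum, hz, ← Real.exp_nat_mul, ENNReal.coe_toReal]
      push_cast
      ring_nf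
    · intro n hn
      rw [if_neg (fun h => hn (Finset.mem_range.2 ((hiff n).1 h))), mul_zero]
  · push Not at hex
    rw [entryTime_eq_top hex, discount, if_pos rfl]
    have : ∀ n : ℕ, (if ∀ j : ℕ, 1 ≤ j → j ≤ n → X (j * H) ω ∉ G then (1 : ℝ) else 0) = 1 :=
      fun n => if_pos fun j hj _ => hex j hj
    simp only [this, mul_one]
    rw [tsum_geometric_of_lt_one hz0 hz1, mul_inv_cancel₀ (by linarith), sub_self]

end Path

/-! ### The Black–Scholes log-price on a mesh -/

section LogPrice

variable {Ω : Type*} [MeasurableSpace Ω] {r σ : ℝ} {B X : ℝ≥0 → Ω → ℝ} {P : ℝ → Measure Ω}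

/-- The increments of the log-price process over the `i`-th interval of the mesh of size `H`. -/
noncomputable def step (r σ : ℝ) (B : ℝ≥0 → Ω → ℝ) (H : ℝ≥0) (i : ℕ) (ω : Ω) : ℝ :=
  σ * (B ((i + 1 : ℕ) * H) ω - B (i * H) ω) + (r - σ ^ 2 / 2) * H

lemma iIndepFun_step {Q : Measure Ω} (hB : IsPreBrownianReal B Q) (H : ℝ≥0) :
    iIndepFun (step r σ B H) Q := by
  have hmono : Monotone fun n : ℕ => (n : ℝ≥0) * H := fun a b hab => by
    have : (a : ℝ≥0) ≤ b := by exact_mod_cast hab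
    dsimp only
    gcongr
  exact (hB.hasIndepIncrements.nat hmono).comp (fun _ y => σ * y + (r - σ ^ 2 / 2) * H)
    (fun _ => by fun_prop)

lemma hasLaw_step {Q : Measure Ω} (hB : IsPreBrownianReal B Q) (H : ℝ≥0) (i : ℕ) :
    HasLaw (step r σ B H i) (incrementLaw (r - σ ^ 2 / 2) σ H) Q := by
  have h := hB.hasLaw_sub ((i + 1 : ℕ) * H) (i * H)
  have hd : nndist ((i + 1 : ℕ) * H : ℝ≥0).1 (i * H : ℝ≥0).1 = H := by
    ext
    rw [coe_nndist, Real.dist_eq]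
    change |(((i + 1 : ℕ) * H : ℝ≥0) : ℝ) - ((i * H : ℝ≥0) : ℝ)| = H
    push_cast
    rw [show ((i : ℝ) + 1) * H - i * H = H by ring, abs_of_nonneg H.coe_nonneg]
  have hlaw : ((gaussianReal 0 H).map (fun y => σ * y)).map (fun y => y + (r - σ ^ 2 / 2) * H) =
      incrementLaw (r - σ ^ 2 / 2) σ H := by
    rw [gaussianReal_map_const_mul, gaussianReal_map_add_const, mul_zero, zero_add]
    congr 1
    ext
    rw [Real.coe_toNNReal _ (by positivity)]
    simp
  rw [hd] at h
  refine (HasLaw.mk (by fun_prop) ?_ :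
    HasLaw (fun y => σ * y + (r - σ ^ 2 / 2) * H) _ (gaussianReal 0 H)).comp h
  rw [← hlaw, Measure.map_map (by fun_prop) (by fun_prop)]
  rfl

lemma IsBlackScholesLogPrice.ae_eq_sum_step (hX : IsBlackScholesLogPrice r σ B X P) (γ : ℝ)
    (H : ℝ≥0) :
    ∀ᵐ ω ∂(P γ), ∀ j : ℕ, X (j * H) ω = γ + ∑ i ∈ Finset.range j, step r σ B H i ω := by
  filter_upwards [hX.start γ, hX.path γ,
    (hX.brownian γ).toIsPreBrownianReal.eval_zero_ae_eq_zero] with ω h0 hpath hB0 j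
  rw [hpath, h0]
  simp only [step]
  rw [Finset.sum_add_distrib, ← Finset.mul_sum,
    Finset.sum_range_sub (fun i : ℕ => B ((i : ℝ≥0) * H) ω), Finset.sum_const, Finset.card_range]
  simp only [Nat.cast_zero, zero_mul, hB0, nsmul_eq_mul]
  push_cast
  ring

/-- The expected discount factor at the entry time, in terms of the walk of the increments. -/
lemma IsBlackScholesLogPrice.integral_discount (hX : IsBlackScholesLogPrice r σ B X P)
    (hr : 0 < r) (γ : ℝ) {G : Set ℝ} (hG : MeasurableSet G) {H : ℝ≥0} (hH : 0 < H) :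
    Integrable (fun ω => discount r (entryTime X G (mesh H) ω)) (P γ) ∧
    ∫ ω, discount r (entryTime X G (mesh H) ω) ∂(P γ) =
      1 - escape (incrementLaw (r - σ ^ 2 / 2) σ H) {y | γ + y ∉ G} (Real.exp (-r * H)) := by
  classical
  have hB := (hX.brownian γ).toIsPreBrownianReal
  have : IsProbabilityMeasure (P γ) := hB.isGaussianProcess.isProbabilityMeasure
  set z := Real.exp (-r * H) with hz
  have hz0 : 0 ≤ z := (Real.exp_pos _).le
  have hz1 : z < 1 := by
    rw [hz, Real.exp_lt_one_iff]
    have : 0 < (H : ℝ) := hH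
    nlinarith
  set D : Set ℝ := {y | γ + y ∉ G} with hD
  have hDm : MeasurableSet D := (by fun_prop : Measurable fun y => γ + y) hG.compl
  set A : ℕ → Set Ω := fun n => {ω | (fun i => step r σ B H i ω) ∈ survivalSet D n} with hA
  have hAm : ∀ n, NullMeasurableSet (A n) (P γ) := fun n =>
    (aemeasurable_pi_iff.2 fun i => (hasLaw_step hB H i).aemeasurable).nullMeasurableSet_preimage
      (measurableSet_survivalSet hDm n)
  set F : ℕ → Ω → ℝ := fun n => (A n).indicator fun _ => z ^ n with hF
  have hFint : ∀ n, Integrable (F n) (P γ) := fun n =>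
    (integrable_const _).indicator₀ (hAm n)
  have hF0 : ∀ n ω, 0 ≤ F n ω := fun n ω => indicator_nonneg (fun _ _ => pow_nonneg hz0 n) ω
  have hFle : ∀ n ω, F n ω ≤ z ^ n := fun n ω =>
    indicator_le_self' (fun _ _ => pow_nonneg hz0 n) ω
  have hFI : ∀ n, ∫ ω, F n ω ∂(P γ) =
      z ^ n * survival (incrementLaw (r - σ ^ 2 / 2) σ H) D n := by
    intro n
    rw [integral_indicator₀ (hAm n), setIntegral_const, smul_eq_mul, mul_comm]
    congr 1
    exact survival_eq_of_iIndepFun (iIndepFun_step hB H) (hasLaw_step hB H) hDm n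
  have hae : (fun ω => discount r (entryTime X G (mesh H) ω)) =ᵐ[P γ]
      fun ω => 1 - (1 - z) * ∑' n, F n ω := by
    filter_upwards [hX.ae_eq_sum_step γ H] with ω hω
    rw [discount_entryTime hr hH]
    congr 2
    refine tsum_congr fun n => ?_
    have : (∀ j : ℕ, 1 ≤ j → j ≤ n → X (j * H) ω ∉ G) ↔ ω ∈ A n := by
      simp only [hω]
      rfl
    simp only [this, hF, Set.indicator_apply, mul_ite, mul_one, mul_zero, hz]
  have hsum : Summable fun n => ∫ ω, ‖F n ω‖ ∂(P γ) := by
    simp_rw [Real.norm_of_nonneg (hF0 _ _), hFI]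
    exact summable_survival hz0 hz1
  have hgeo := summable_geometric_of_lt_one hz0 hz1
  have htsum : Integrable (fun ω => ∑' n, F n ω) (P γ) := by
    have hlim : AEStronglyMeasurable (fun ω => ∑' n, F n ω) (P γ) :=
      aestronglyMeasurable_of_tendsto_ae atTop
        (fun N => Finset.aestronglyMeasurable_fun_sum (Finset.range N)
          fun n _ => (hFint n).aestronglyMeasurable)
        (ae_of_all _ fun ω => (hgeo.of_nonneg_of_le (fun n => hF0 n ω)
          fun n => hFle n ω).hasSum.tendsto_sum_nat)
    refine (integrable_const (∑' n, z ^ n)).mono' hlim (ae_of_all _ fun ω => ?_)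
    rw [Real.norm_of_nonneg (tsum_nonneg fun n => hF0 n ω)]
    exact (hgeo.of_nonneg_of_le (fun n => hF0 n ω) fun n => hFle n ω).tsum_le_tsum
      (fun n => hFle n ω) hgeo
  refine ⟨((integrable_const 1).sub (htsum.const_mul (1 - z))).congr hae.symm, ?_⟩
  rw [integral_congr_ae hae, integral_sub (integrable_const _) (htsum.const_mul _),
    integral_const_mul, ← integral_tsum_of_summable_integral_norm hFint hsum, escape]
  simp_rw [hFI]
  simp

lemma IsBlackScholesLogPrice.discountGap_eq (hX : IsBlackScholesLogPrice r σ B X P)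
    (hr : 0 < r) (γ : ℝ) {G : Set ℝ} (hG : MeasurableSet G) {s t : ℝ} (hs : 0 < s) (ht : 0 < t) :
    discountGap r X (P γ) G s t =
      escape (incrementLaw (r - σ ^ 2 / 2) σ s) {y | γ + y ∉ G} (Real.exp (-r * s)) -
      escape (incrementLaw (r - σ ^ 2 / 2) σ t) {y | γ + y ∉ G} (Real.exp (-r * t)) := by
  lift s to ℝ≥0 using hs.le
  lift t to ℝ≥0 using ht.le
  obtain ⟨h1, h2⟩ := hX.integral_discount hr γ hG (H := s) hs
  obtain ⟨h3, h4⟩ := hX.integral_discount hr γ hG (H := t) ht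
  rw [discountGap, integral_sub h3 h1, h2, h4]
  ring

/-- The continuity correction at the boundary point exists and is of exact order `√s`, whatever
the sign of the drift. -/
lemma IsBlackScholesLogPrice.rho_bounds (hX : IsBlackScholesLogPrice r σ B X P)
    (hr : 0 < r) (hσ : 0 < σ) {γ : ℝ} {G : Set ℝ} (hG : G = Iic γ ∨ G = Iio γ) :
    (∀ s : ℝ, 0 < s → Tendsto (fun t => discountGap r X (P γ) G s t) (𝓝[>] 0)
      (𝓝 (rho r X P G s γ))) ∧
    ∃ c C : ℝ, 0 < c ∧ 0 < C ∧ ∀ᶠ s : ℝ in 𝓝[>] 0,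
      c * √s ≤ rho r X P G s γ ∧ rho r X P G s γ ≤ C * √s := by
  have hGm : MeasurableSet G := by
    rcases hG with rfl | rfl
    · exact measurableSet_Iic
    · exact measurableSet_Iio
  set D : Set ℝ := {y | γ + y ∉ G} with hD
  have hDm : MeasurableSet D := (by fun_prop : Measurable fun y => γ + y) hGm.compl
  have hD1 : Ioi 0 ⊆ D := by
    intro y hy
    have hy : 0 < y := hy
    rcases hG with rfl | rfl
    · simpa [hD] using hy
    · simpa [hD] using hy.le
  have hD2 : D ⊆ Ici 0 := by
    intro y hy
    rcases hG with rfl | rfl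
    · simp only [hD, mem_ofPred_eq, mem_Iic, not_le] at hy
      exact (by linarith : 0 ≤ y)
    · simp only [hD, mem_ofPred_eq, mem_Iio, not_lt] at hy
      exact (by linarith : 0 ≤ y)
  obtain ⟨c, C, hc, hC, hbd⟩ := exists_escape_bounds hr hσ (r - σ ^ 2 / 2)
  set u : ℝ → ℝ := fun s => escape (incrementLaw (r - σ ^ 2 / 2) σ s) D (Real.exp (-r * s))
    with hu
  have hu0 : Tendsto u (𝓝[>] 0) (𝓝 0) := by
    refine tendsto_of_tendsto_of_tendsto_of_le_of_le' (tendsto_const_mul_sqrt c)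
      (tendsto_const_mul_sqrt C) ?_ ?_
    · filter_upwards [hbd] with s hs using (hs D hDm hD1 hD2).1
    · filter_upwards [hbd] with s hs using (hs D hDm hD1 hD2).2
  have hlim : ∀ s : ℝ, 0 < s →
      Tendsto (fun t => discountGap r X (P γ) G s t) (𝓝[>] 0) (𝓝 (u s)) := by
    intro s hs
    have h := (tendsto_const_nhds (x := u s)).sub hu0
    rw [sub_zero] at h
    refine h.congr' ?_
    filter_upwards [self_mem_nhdsWithin] with t ht
    exact (hX.discountGap_eq hr γ hGm hs ht).symm
  have hrho : ∀ s : ℝ, 0 < s → rho r X P G s γ = u s := fun s hs => (hlim s hs).limUnder_eq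
  refine ⟨fun s hs => ?_, c, C, hc, hC, ?_⟩
  · rw [hrho s hs]
    exact hlim s hs
  · filter_upwards [hbd, self_mem_nhdsWithin] with s hs hpos
    rw [hrho s hpos]
    exact hs D hDm hD1 hD2

end LogPrice

/-! ### Functions of order `√s` are not polynomial -/

/-- A polynomial is within `O(s)` of its value at `0`, and `√s` is not `O(s)`. -/
lemma not_polynomial_of_sqrt_bounds {f : ℝ → ℝ} {c C : ℝ} (hc : 0 < c)
    (hf : ∀ᶠ s : ℝ in 𝓝[>] 0, c * √s ≤ f s ∧ f s ≤ C * √s) :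
    ¬ ∃ p : Polynomial ℝ, (fun s : ℝ => f s - p.eval s) =O[𝓝[>] (0 : ℝ)] (fun s : ℝ => s) := by
  rintro ⟨p, hp⟩
  have hid : Tendsto (fun s : ℝ => s) (𝓝[>] 0) (𝓝 0) := tendsto_id.mono_left nhdsWithin_le_nhds
  have hf0 : Tendsto f (𝓝[>] 0) (𝓝 0) :=
    tendsto_of_tendsto_of_tendsto_of_le_of_le' (tendsto_const_mul_sqrt c)
      (tendsto_const_mul_sqrt C) (hf.mono fun s hs => hs.1) (hf.mono fun s hs => hs.2)
  have hp1 : Tendsto (fun s => p.eval s) (𝓝[>] 0) (𝓝 0) := by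
    simpa using hf0.sub (hp.trans_tendsto hid)
  have hp2 : p.eval 0 = 0 :=
    tendsto_nhds_unique ((p.continuous.tendsto 0).mono_left nhdsWithin_le_nhds) hp1
  have hp3 : (fun s => p.eval s) =O[𝓝[>] (0 : ℝ)] fun s => s := by
    have h := (p.differentiable.differentiableAt (x := (0 : ℝ))).isBigO_sub
    simp only [hp2, sub_zero] at h
    exact h.mono nhdsWithin_le_nhds
  have hfO : f =O[𝓝[>] (0 : ℝ)] fun s => s := by simpa using hp.add hp3
  obtain ⟨K, hK⟩ := hfO.bound
  have hev : ∀ᶠ s : ℝ in 𝓝[>] 0, c ≤ K * √s := by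
    filter_upwards [hK, hf, self_mem_nhdsWithin] with s h1 h2 h3
    have h3 : 0 < s := h3
    have hs : 0 < √s := Real.sqrt_pos.2 h3
    rw [Real.norm_of_nonneg h3.le] at h1
    have h4 : c * √s ≤ K * √s * √s := by
      rw [mul_assoc, Real.mul_self_sqrt h3.le]
      exact (h2.1.trans (le_abs_self _)).trans h1
    exact le_of_mul_le_mul_right h4 hs
  exact absurd (ge_of_tendsto (tendsto_const_mul_sqrt K) hev) (not_le.2 hc)

end BermudanOption

theorem mainTheorem5 {Ω : Type*} [MeasurableSpace Ω] (r σ : ℝ) (hr : 0 < r) (hσ : 0 < σ)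
    (B X : ℝ≥0 → Ω → ℝ) (P : ℝ → Measure Ω)
    (hX : BermudanOption.IsBlackScholesLogPrice r σ B X P)
    (γ : ℝ) (G : Set ℝ) (hG : G = Set.Iic γ ∨ G = Set.Iio γ)
    (μ : ℝ) (hμ : μ = r - σ ^ 2 / 2) :
    -- the limit that defines the continuity correction at the boundary point exists
    (∀ s : ℝ, 0 < s →
      Tendsto (fun t => BermudanOption.discountGap r X (P γ) G s t) (𝓝[>] (0 : ℝ))
        (𝓝 (BermudanOption.rho r X P G s γ))) ∧
    -- bounds for nonnegative drift
    (0 ≤ μ → ∃ c₀ C₀ : ℝ, 0 < c₀ ∧ 0 < C₀ ∧ ∀ᶠ s : ℝ in 𝓝[>] (0 : ℝ),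
      c₀ * s ^ (1 / 2 : ℝ) ≤ BermudanOption.rho r X P G s γ ∧
      BermudanOption.rho r X P G s γ ≤ C₀ * s ^ (1 / (2 * Real.sqrt 2) : ℝ)) ∧
    -- bounds for nonpositive drift
    (μ ≤ 0 → μ ^ 2 / (2 * σ ^ 2) < r → ∃ c₁ C₁ : ℝ, 0 < c₁ ∧ 0 < C₁ ∧ ∀ᶠ s : ℝ in 𝓝[>] (0 : ℝ),
      c₁ * s ^ (1 / Real.sqrt 2 : ℝ) ≤ BermudanOption.rho r X P G s γ ∧
      BermudanOption.rho r X P G s γ ≤ C₁ * s ^ (1 / 2 : ℝ)) ∧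
    -- in both cases the correction is not polynomial in the mesh size, not even up to `O(s)`
    ((0 ≤ μ ∨ (μ ≤ 0 ∧ μ ^ 2 / (2 * σ ^ 2) < r)) →
      ¬ ∃ p : Polynomial ℝ,
        (fun s : ℝ => BermudanOption.rho r X P G s γ - p.eval s) =O[𝓝[>] (0 : ℝ)]
          (fun s : ℝ => s)) := by
  obtain ⟨hlim, c, C, hc, hC, hbd⟩ := hX.rho_bounds hr hσ hG
  have hone : ∀ᶠ s : ℝ in 𝓝[>] 0, 0 < s ∧ s ≤ 1 := by
    filter_upwards [Ioc_mem_nhdsGT (zero_lt_one' ℝ)] with s hs using hs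
  have hsqrt : 1 ≤ √(2 : ℝ) := Real.one_le_sqrt.2 one_le_two
  have hsqrt2 : √(2 : ℝ) ≤ 2 := Real.sqrt_le_iff.2 ⟨by norm_num, by norm_num⟩
  refine ⟨hlim, fun _ => ⟨c, C, hc, hC, ?_⟩, fun _ _ => ⟨c, C, hc, hC, ?_⟩,
    fun _ => BermudanOption.not_polynomial_of_sqrt_bounds hc hbd⟩
  · filter_upwards [hbd, hone] with s hs h1
    rw [Real.sqrt_eq_rpow] at hs
    refine ⟨hs.1, hs.2.trans (mul_le_mul_of_nonneg_left
      (Real.rpow_le_rpow_of_exponent_ge h1.1 h1.2 ?_) hC.le)⟩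
    exact one_div_le_one_div_of_le two_pos (by linarith)
  · filter_upwards [hbd, hone] with s hs h1
    rw [Real.sqrt_eq_rpow] at hs
    refine ⟨(mul_le_mul_of_nonneg_left
      (Real.rpow_le_rpow_of_exponent_ge h1.1 h1.2 ?_) hc.le).trans hs.1, hs.2⟩
    exact one_div_le_one_div_of_le (by positivity) hsqrt2
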